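/- Let $N\ge 1$, and let $|\Psi\rangle=\sum_{i=1}^{2}\sum_{j,k=1}^{N}\gamma_{ijk}\,|i\rangle\otimes|j\rangle\otimes|k\rangle$ be a (not necessarily normalized) pure state in $\mathbb{C}^2\otimes\mathbb{C}^N\otimes\mathbb{C}^N$, represented by the pair of $N\times N$ complex matrices $\Gamma_1=(\gamma_{1jk})_{j,k}$, $\Gamma_2=(\gamma_{2jk})_{j,k}$. Call $|\Psi\rangle$ truly entangled if the reduced density matrices $\rho_0,\rho_1,\rho_2$ of $|\Psi\rangle\langle\Psi|$ on the three factors have full rank, that is, $\operatorname{rank}\rho_0=2$ and $\operatorname{rank}\rho_1=\operatorname{rank}\rho_2=N$. For integers $n,l\ge 0$ let $C_{n,l}$ be the set of the states for which $$\max_{(\alpha,\beta)\neq(0,0)}\operatorname{rank}(\alpha\Gamma_1+\beta\Gamma_2)=n,\qquad \min_{(\alpha,\beta)\neq(0,0)}\operatorname{rank}(\alpha\Gamma_1+\beta\Gamma_2)=l,$$ where $\alpha,\beta$ range over $\mathbb{C}$. Suppose that $|\Psi\rangle$ is truly entangled and belongs to $C_{n,l}$. If $n<N$, then $$2(N-n)\le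 l\le n,\qquad\text{and hence}\qquad \frac{2N}{3}\le n<N.$$ If $n=N$, then $0<l<N$. -/

import Mathlib

/-- A (not necessarily normalized) pure state of a `2 × N × N` system, given by its coefficients
`γ i j k` in the product basis `|i⟩ ⊗ |j⟩ ⊗ |k⟩`. -/
abbrev TripartiteState (N : ℕ) : Type := Fin 2 → Fin N → Fin N → ℂ

namespace TripartiteState

variable {N : ℕ}

/-- The matrix `Γ₁` (for `i = 0`) or `Γ₂` (for `i = 1`) of the matrix pair representing the
state. -/
def slice (γ : TripartiteState N) (i : Fin 2) : Matrix (Fin N) (Fin N) ℂ :=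
  Matrix.of (γ i)

/-- The density matrix `|Ψ⟩⟨Ψ|`. -/
def density (γ : TripartiteState N) :
    Matrix (Fin 2 × Fin N × Fin N) (Fin 2 × Fin N × Fin N) ℂ :=
  Matrix.of fun x y => γ x.1 x.2.1 x.2.2 * star (γ y.1 y.2.1 y.2.2)

/-- The reduced density matrix of the qubit. -/
def reduced₀ (γ : TripartiteState N) : Matrix (Fin 2) (Fin 2) ℂ :=
  Matrix.of fun i i' => ∑ j, ∑ k, γ.density (i, j, k) (i', j, k)

/-- The reduced density matrix of the first `N`-dimensional party. -/
def reduced₁ (γ : TripartiteState N) : Matrix (Fin N) (Fin N) ℂ :=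
  Matrix.of fun j j' => ∑ i, ∑ k, γ.density (i, j, k) (i, j', k)

/-- The reduced density matrix of the second `N`-dimensional party. -/
def reduced₂ (γ : TripartiteState N) : Matrix (Fin N) (Fin N) ℂ :=
  Matrix.of fun k k' => ∑ i, ∑ j, γ.density (i, j, k) (i, j, k')

/-- A state is truly entangled when all its reduced density matrices have full rank. -/
def IsTrulyEntangled (γ : TripartiteState N) : Prop :=
  γ.reduced₀.rank = 2 ∧ γ.reduced₁.rank = N ∧ γ.reduced₂.rank = N

/-- The set of ranks of the matrices `α Γ₁ + β Γ₂` with `(α, β) ≠ (0, 0)`. -/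
def pencilRanks (γ : TripartiteState N) : Set ℕ :=
  {r | ∃ α β : ℂ, (α, β) ≠ (0, 0) ∧ (α • γ.slice 0 + β • γ.slice 1).rank = r}

/-- The set `C_{n,l}` of the states whose pencil `α Γ₁ + β Γ₂`, `(α, β) ≠ (0, 0)`, has maximal
rank `n` and minimal rank `l`. -/
def rankClass (N n l : ℕ) : Set (TripartiteState N) :=
  {γ | IsGreatest γ.pencilRanks n ∧ IsLeast γ.pencilRanks l}

end TripartiteState

/-!
The coefficients `γ` define a linear map `P` from `ℂ²` to the linear maps `ℂᴺ → ℂᴺ`, whose values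
at nonzero points are the matrices `α Γ₁ + β Γ₂`, and the full ranks of `ρ₀`, `ρ₁`, `ρ₂` say that
`P` is injective, that the ranges of its values span the codomain, and that their kernels share no
nonzero vector.

Let `P x` have maximal rank `n`. If `P y` sent some `v ∈ ker (P x)` outside `range (P x)`, then
`range (P x + t P y)`, which contains `P y v` for `t ≠ 0`, would have dimension at least `n + 1` for
generic `t`. So `P y` maps `ker (P x)`, injectively if `y` is independent of `x`, into
`range (P x) ∩ range (P y)`. As the two ranges span, this gives `N - n ≤ n + rank (P y) - N`.
The remaining bounds hold because `P` is injective and because `det (P z)` vanishes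
at some `z ≠ 0`.
-/

open Module

section LinearMap

variable {K V W : Type*} [Field K] [AddCommGroup V] [Module K V] [AddCommGroup W] [Module K W]

theorem finrank_range_lt_of_not_injective [FiniteDimensional K V] {f : V →ₗ[K] W}
    (hf : ¬ Function.Injective f) : finrank K f.range < finrank K V := by
  have hker : finrank K f.ker ≠ 0 := fun h =>
    hf (LinearMap.ker_eq_bot.1 (Submodule.finrank_eq_zero.1 h))
  have hsum := f.finrank_range_add_finrank_ker
  omega

theorem exists_ne_zero_injective_add_smul [Infinite K] [FiniteDimensional K V] {f : V →ₗ[K] W}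
    (hf : Function.Injective f) (g : V →ₗ[K] W) :
    ∃ t : K, t ≠ 0 ∧ Function.Injective (f + t • g) := by
  obtain ⟨L, hL⟩ := f.exists_leftInverse_of_injective (LinearMap.ker_eq_bot.2 hf)
  obtain ⟨μ, hμ⟩ := ((End.finite_hasEigenvalue (L ∘ₗ g)).insert 0).exists_notMem
  obtain ⟨hμ0, hμL⟩ := not_or.1 hμ
  refine ⟨-μ⁻¹, neg_ne_zero.2 (inv_ne_zero hμ0), (injective_iff_map_eq_zero _).2 fun x hx => ?_⟩
  by_contra hx0
  have hLx : x - μ⁻¹ • L (g x) = 0 := by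
    simpa [← LinearMap.comp_apply L f, hL, sub_eq_add_neg] using congrArg L hx
  refine hμL (End.hasEigenvalue_of_hasEigenvector (x := x) ⟨End.mem_eigenspace_iff.2 ?_, hx0⟩)
  rw [LinearMap.comp_apply, sub_eq_zero.1 hLx, smul_inv_smul₀ hμ0, ← sub_eq_zero.1 hLx]

theorem map_ker_le_range_of_finrank_range_add_smul_le [Infinite K] [FiniteDimensional K W]
    {f g : V →ₗ[K] W} (hmax : ∀ t : K, finrank K (f + t • g).range ≤ finrank K f.range) :
    f.ker.map g ≤ f.range := by
  rintro _ ⟨v, hv, rfl⟩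
  by_contra hgv
  have hfv : f v = 0 := hv
  obtain ⟨s, hs⟩ := f.rangeRestrict.exists_rightInverse_of_surjective f.range_rangeRestrict
  have hfs (y : f.range) : f (s y) = y := congrArg Subtype.val (LinearMap.congr_fun hs y)
  let F : f.range × K →ₗ[K] W := f.range.subtype.coprod (LinearMap.toSpanSingleton K W (g v))
  have hF : Function.Injective F := by
    have hgv0 : g v ≠ 0 := fun h => hgv (h ▸ f.range.zero_mem)
    rw [← LinearMap.ker_eq_bot, LinearMap.ker_coprod_of_disjoint_range, Submodule.ker_subtype,
      LinearMap.ker_toSpanSingleton K hgv0, Submodule.prod_bot]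
    rw [Submodule.range_subtype, LinearMap.range_toSpanSingleton]
    exact (Submodule.disjoint_span_singleton' hgv0).2 hgv
  obtain ⟨t, ht, hinj⟩ :=
    exists_ne_zero_injective_add_smul hF (g ∘ₗ s ∘ₗ LinearMap.fst K f.range K)
  have hle : (F + t • g ∘ₗ s ∘ₗ LinearMap.fst K f.range K).range ≤ (f + t • g).range := by
    rintro _ ⟨⟨y, c⟩, rfl⟩
    have hpreimage : (f + t • g) (s y + (c * t⁻¹) • v) = y + c • g v + t • g (s y) := by
      simp only [LinearMap.add_apply, LinearMap.smul_apply, map_add, map_smul, hfs, hfv]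
      match_scalars <;> field_simp
    exact ⟨_, hpreimage⟩
  have hlt : finrank K f.range + 1 ≤ finrank K (f + t • g).range := by
    simpa [LinearMap.finrank_range_of_inj hinj] using Submodule.finrank_mono hle
  exact absurd (hmax t) (by omega)

theorem finrank_ker_add_finrank_le_of_finrank_range_add_smul_le [Infinite K]
    [FiniteDimensional K W] {f g : V →ₗ[K] W}
    (hmax : ∀ t : K, finrank K (f + t • g).range ≤ finrank K f.range)
    (hker : Disjoint f.ker g.ker) (hrange : f.range ⊔ g.range = ⊤) :
    finrank K f.ker + finrank K W ≤ finrank K f.range + finrank K g.range := by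
  have hmap : finrank K (f.ker.map g) = finrank K f.ker := by
    rw [← LinearMap.range_domRestrict]
    exact LinearMap.finrank_range_of_inj (LinearMap.injective_domRestrict_iff.2 hker)
  calc
    finrank K f.ker + finrank K W
        = finrank K (f.ker.map g) + finrank K ↥(f.range ⊔ g.range) := by
      rw [hmap, hrange, finrank_top]
    _ ≤ finrank K ↥(f.range ⊓ g.range) + finrank K ↥(f.range ⊔ g.range) := by
      gcongr
      exact Submodule.finrank_mono
        (le_inf (map_ker_le_range_of_finrank_range_add_smul_le hmax) LinearMap.map_le_range)
    _ = finrank K f.range + finrank K g.range := by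
      rw [add_comm, Submodule.finrank_sup_add_finrank_inf_eq]

end LinearMap

/-- A linear family of linear maps `V → W` with parameter space `E`, that is, a tensor in
`E* ⊗ V* ⊗ W`. For `E` of dimension two it is a pencil in the classical sense, with the choice of
two matrices spanning it replaced by the choice of a basis of `E`. -/
abbrev LinearPencil (K E V W : Type*) [Field K] [AddCommGroup E] [Module K E] [AddCommGroup V]
    [Module K V] [AddCommGroup W] [Module K W] : Type _ :=
  E →ₗ[K] V →ₗ[K] W

namespace LinearPencil

variable {K E V W : Type*} [Field K] [AddCommGroup E] [Module K E] [AddCommGroup V] [Module K V]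
  [AddCommGroup W] [Module K W] {P : LinearPencil K E V W} {x y : E} {n l : ℕ}

/-- A pencil is concise when, seen as a tensor, it does not come from a proper quotient of `E` or
`V` or from a proper subspace of `W`. This is the analogue over any field of true entanglement. -/
structure IsConcise (P : LinearPencil K E V W) : Prop where
  injective : Function.Injective P
  flip_injective : Function.Injective P.flip
  iSup_range_eq_top : ⨆ x, (P x).range = ⊤

/-- The ranks of the members of a pencil at the nonzero parameters. -/
def ranks (P : LinearPencil K E V W) : Set ℕ :=
  {r | ∃ x ≠ 0, finrank K (P x).range = r}

theorem disjoint_ker_of_span_eq_top (hP : Function.Injective P.flip)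
    (hxy : Submodule.span K {x, y} = ⊤) : Disjoint (P x).ker (P y).ker := by
  refine LinearMap.disjoint_ker.2 fun v hx hy => (map_eq_zero_iff P.flip hP).1 ?_
  refine LinearMap.ext_on hxy ?_
  rintro _ (rfl | rfl)
  exacts [hx, hy]

theorem range_sup_range_of_span_eq_top (hP : ⨆ z, (P z).range = ⊤)
    (hxy : Submodule.span K {x, y} = ⊤) : (P x).range ⊔ (P y).range = ⊤ := by
  rw [eq_top_iff, ← hP, iSup_le_iff]
  rintro z _ ⟨v, rfl⟩
  obtain ⟨a, b, rfl⟩ := Submodule.mem_span_pair.1 (hxy ▸ Submodule.mem_top : z ∈ _)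
  simp only [map_add, map_smul, LinearMap.add_apply, LinearMap.smul_apply]
  exact Submodule.add_mem_sup (Submodule.smul_mem _ a ⟨v, rfl⟩) (Submodule.smul_mem _ b ⟨v, rfl⟩)

theorem exists_linearIndependent_finrank_range_le (hE : 1 < finrank K E)
    (hmax : ∀ z ≠ 0, finrank K (P z).range ≤ finrank K (P x).range) (hx : x ≠ 0) (hy : y ≠ 0) :
    ∃ z, LinearIndependent K ![x, z] ∧ finrank K (P z).range ≤ finrank K (P y).range := by
  by_cases hxy : LinearIndependent K ![x, y]
  · exact ⟨y, hxy, le_rfl⟩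
  obtain ⟨a, rfl⟩ : ∃ a : K, a • x = y := by
    simpa only [LinearIndependent.pair_iff' hx, not_forall, not_not] using hxy
  obtain ⟨z, hxz⟩ := exists_linearIndependent_pair_of_one_lt_finrank hE hx
  refine ⟨z, hxz, ?_⟩
  rw [map_smul, LinearMap.range_smul _ _ (left_ne_zero_of_smul hy)]
  exact hmax z (hxz.ne_zero 1)

theorem finrank_add_finrank_le_of_linearIndependent [Infinite K] [FiniteDimensional K V]
    [FiniteDimensional K W] (hE : finrank K E = 2) (hV : Function.Injective P.flip)
    (hW : ⨆ z, (P z).range = ⊤) (hxy : LinearIndependent K ![x, y])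
    (hmax : ∀ z ≠ 0, finrank K (P z).range ≤ finrank K (P x).range) :
    finrank K V + finrank K W ≤ 2 * finrank K (P x).range + finrank K (P y).range := by
  have : FiniteDimensional K E := .of_finrank_pos (by omega)
  have hspan : Submodule.span K {x, y} = ⊤ := by
    simpa [Set.pair_comm] using hxy.span_eq_top_of_card_eq_finrank' (by simp [hE])
  have hline (t : K) : finrank K (P x + t • P y).range ≤ finrank K (P x).range := by
    rw [← map_smul, ← map_add]
    refine hmax _ fun h => one_ne_zero (α := K) ?_
    exact (LinearIndependent.pair_iff.1 hxy 1 t (by rwa [one_smul])).1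
  have hle := finrank_ker_add_finrank_le_of_finrank_range_add_smul_le hline
    (disjoint_ker_of_span_eq_top hV hspan) (range_sup_range_of_span_eq_top hW hspan)
  have hsum := (P x).finrank_range_add_finrank_ker
  omega

theorem finrank_add_finrank_le_two_mul_add [Infinite K] [FiniteDimensional K V]
    [FiniteDimensional K W] (hE : finrank K E = 2) (hV : Function.Injective P.flip)
    (hW : ⨆ z, (P z).range = ⊤) (hn : IsGreatest P.ranks n) (hl : l ∈ P.ranks) :
    finrank K V + finrank K W ≤ 2 * n + l := by
  obtain ⟨⟨x, hx, rfl⟩, hub⟩ := hn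
  obtain ⟨y, hy, rfl⟩ := hl
  have hmax : ∀ z ≠ 0, finrank K (P z).range ≤ finrank K (P x).range := fun z hz => hub ⟨z, hz, rfl⟩
  obtain ⟨z, hxz, hzy⟩ := exists_linearIndependent_finrank_range_le (by omega) hmax hx hy
  have hle := finrank_add_finrank_le_of_linearIndependent hE hV hW hxz hmax
  omega

theorem pos_of_mem_ranks [FiniteDimensional K W] (hP : Function.Injective P) (hl : l ∈ P.ranks) :
    0 < l := by
  obtain ⟨x, hx, rfl⟩ := hl
  refine Nat.pos_of_ne_zero fun h => hx ((map_eq_zero_iff P hP).1 ?_)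
  exact LinearMap.range_eq_bot.1 (Submodule.finrank_eq_zero.1 h)

theorem exists_ne_zero_not_injective [IsAlgClosed K] [FiniteDimensional K V] [Nontrivial V]
    [FiniteDimensional K W] (P : LinearPencil K E V W) (hE : 1 < finrank K E)
    (hVW : finrank K V = finrank K W) : ∃ z ≠ 0, ¬ Function.Injective (P z) := by
  by_contra! hinj
  have : Nontrivial E := nontrivial_of_finrank_pos (zero_lt_one.trans hE)
  obtain ⟨x, hx⟩ := exists_ne (0 : E)
  obtain ⟨y, hxy⟩ := exists_linearIndependent_pair_of_one_lt_finrank hE hx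
  let e : V ≃ₗ[K] W := (P x).linearEquivOfInjective (hinj x hx) hVW
  obtain ⟨μ, hμ⟩ := End.exists_eigenvalue (e.symm.toLinearMap ∘ₗ P y)
  obtain ⟨v, hv⟩ := hμ.exists_hasEigenvector
  have hPv : P y v = μ • P x v := by
    simpa [e] using congrArg e hv.apply_eq_smul
  have hne : y - μ • x ≠ 0 := fun h =>
    (LinearIndependent.pair_iff' hx).1 hxy μ (sub_eq_zero.1 h).symm
  exact hv.2 (hinj _ hne (by simp [hPv]))

theorem lt_finrank_of_isLeast_ranks [IsAlgClosed K] [FiniteDimensional K V] [Nontrivial V]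
    [FiniteDimensional K W] (hE : 1 < finrank K E) (hVW : finrank K V = finrank K W)
    (hl : IsLeast P.ranks l) : l < finrank K V := by
  obtain ⟨z, hz, hPz⟩ := P.exists_ne_zero_not_injective hE hVW
  exact (hl.2 ⟨z, hz, rfl⟩).trans_lt (finrank_range_lt_of_not_injective hPz)

end LinearPencil

theorem mulVec_injective_of_rank_eq_card {K m n : Type*} [Field K] [Fintype n]
    {A : Matrix m n K} (hA : A.rank = Fintype.card n) : Function.Injective A.mulVec := by
  by_contra hinj
  have hlt : A.rank < finrank K (n → K) :=
    finrank_range_lt_of_not_injective (f := A.mulVecLin) hinj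
  simp [hA] at hlt

namespace TripartiteState

open scoped Matrix

variable {N : ℕ} {γ : TripartiteState N}

/-- The pencil `(α, β) ↦ α Γ₁ + β Γ₂` of a state. -/
noncomputable def pencil (γ : TripartiteState N) :
    LinearPencil ℂ (Fin 2 → ℂ) (Fin N → ℂ) (Fin N → ℂ) :=
  Fintype.linearCombination ℂ fun i => (γ.slice i).mulVecLin

theorem pencil_apply (γ : TripartiteState N) (x : Fin 2 → ℂ) :
    γ.pencil x = (∑ i, x i • γ.slice i).mulVecLin := by
  ext
  simp [pencil, Fintype.linearCombination_apply]

theorem pencil_single_apply (γ : TripartiteState N) (i : Fin 2) (v : Fin N → ℂ) :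
    γ.pencil (Pi.single i 1) v = γ.slice i *ᵥ v := by
  simp [pencil]

theorem ranks_pencil (γ : TripartiteState N) : γ.pencil.ranks = γ.pencilRanks := by
  ext r
  constructor
  · rintro ⟨x, hx, rfl⟩
    refine ⟨x 0, x 1, fun h => hx ?_, ?_⟩
    · ext i
      fin_cases i <;> simp_all
    · rw [pencil_apply, Fin.sum_univ_two, Matrix.rank]
  · rintro ⟨α, β, h, rfl⟩
    refine ⟨![α, β], by simpa using h, ?_⟩
    rw [pencil_apply, Fin.sum_univ_two, Matrix.rank]
    rfl

theorem reduced₀_apply (γ : TripartiteState N) (i i' : Fin 2) :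
    γ.reduced₀ i i' = (γ.slice i * (γ.slice i')ᴴ).trace := by
  simp [reduced₀, density, slice, Matrix.trace, Matrix.mul_apply]

theorem reduced₁_eq_sum (γ : TripartiteState N) :
    γ.reduced₁ = ∑ i, γ.slice i * (γ.slice i)ᴴ := by
  ext j j'
  simp [reduced₁, density, slice, Matrix.mul_apply]

theorem transpose_reduced₂_eq_sum (γ : TripartiteState N) :
    γ.reduced₂ᵀ = ∑ i, (γ.slice i)ᴴ * γ.slice i := by
  ext k k'
  simp [reduced₂, density, slice, Matrix.mul_apply, mul_comm]

theorem pencil_injective (h : γ.reduced₀.rank = 2) : Function.Injective γ.pencil := by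
  refine (injective_iff_map_eq_zero _).2 fun x hx => ?_
  have hx0 : ∑ i, x i • γ.slice i = 0 := by
    rw [pencil_apply] at hx
    refine Matrix.mulVec_injective (funext fun v => ?_)
    exact (LinearMap.congr_fun hx v).trans (Matrix.zero_mulVec v).symm
  have hmulVec : γ.reduced₀ᵀ *ᵥ x = 0 := by
    ext i
    calc
      (γ.reduced₀ᵀ *ᵥ x) i = ((∑ i', x i' • γ.slice i') * (γ.slice i)ᴴ).trace := by
        simp [Matrix.mulVec, dotProduct, reduced₀_apply, Matrix.add_mul, mul_comm]
      _ = 0 := by rw [hx0, Matrix.zero_mul, Matrix.trace_zero]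
  refine mulVec_injective_of_rank_eq_card (A := γ.reduced₀ᵀ) ?_ ?_
  · rw [Matrix.rank_transpose, h, Fintype.card_fin]
  · rw [hmulVec, Matrix.mulVec_zero]

theorem pencil_flip_injective (h : γ.reduced₂.rank = N) : Function.Injective γ.pencil.flip := by
  refine (injective_iff_map_eq_zero _).2 fun v hv => ?_
  have hslice (i : Fin 2) : γ.slice i *ᵥ v = 0 := by
    rw [← pencil_single_apply, ← LinearMap.flip_apply, hv, LinearMap.zero_apply]
  refine mulVec_injective_of_rank_eq_card (A := γ.reduced₂ᵀ) ?_ ?_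
  · rw [Matrix.rank_transpose, h, Fintype.card_fin]
  · simp [transpose_reduced₂_eq_sum, Matrix.add_mulVec, ← Matrix.mulVec_mulVec, hslice]

theorem iSup_range_pencil (h : γ.reduced₁.rank = N) : ⨆ x, (γ.pencil x).range = ⊤ := by
  have htop : γ.reduced₁.mulVecLin.range = ⊤ :=
    Submodule.eq_top_of_finrank_eq (h.trans (finrank_fin_fun ℂ).symm)
  rw [eq_top_iff, ← htop]
  rintro _ ⟨v, rfl⟩
  have hsum : γ.reduced₁ *ᵥ v = ∑ i, γ.pencil (Pi.single i 1) ((γ.slice i)ᴴ *ᵥ v) := by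
    simp [reduced₁_eq_sum, pencil_single_apply, Matrix.add_mulVec]
  rw [Matrix.mulVecLin_apply, hsum]
  exact Submodule.sum_mem _ fun i _ => Submodule.mem_iSup_of_mem _ ⟨_, rfl⟩

theorem IsTrulyEntangled.isConcise_pencil (hγ : γ.IsTrulyEntangled) : γ.pencil.IsConcise where
  injective := pencil_injective hγ.1
  flip_injective := pencil_flip_injective hγ.2.2
  iSup_range_eq_top := iSup_range_pencil hγ.2.1

end TripartiteState

theorem mainTheorem3_general {K E V W : Type*} [Field K] [IsAlgClosed K]
    [AddCommGroup E] [Module K E] [AddCommGroup V] [Module K V] [FiniteDimensional K V]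
    [AddCommGroup W] [Module K W] [FiniteDimensional K W] (hE : finrank K E = 2)
    {P : LinearPencil K E V W} (hP : P.IsConcise) {n l : ℕ} (hn : IsGreatest P.ranks n)
    (hl : IsLeast P.ranks l) :
    finrank K V + finrank K W ≤ 2 * n + l ∧ 0 < l ∧
      (finrank K V = finrank K W → l < finrank K V) := by
  have hpos : 0 < l := LinearPencil.pos_of_mem_ranks hP.injective hl.1
  have : Nontrivial V := by
    obtain ⟨x, -, rfl⟩ := hl.1
    exact nontrivial_of_finrank_pos (hpos.trans_le (P x).finrank_range_le)
  exact ⟨LinearPencil.finrank_add_finrank_le_two_mul_add hE hP.flip_injective hP.iSup_range_eq_top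
    hn hl.1, hpos, fun hVW => LinearPencil.lt_finrank_of_isLeast_ranks (by omega) hVW hl⟩

theorem mainTheorem3 (N n l : ℕ) (γ : TripartiteState N) (hγ : γ.IsTrulyEntangled)
    (hC : γ ∈ TripartiteState.rankClass N n l) :
    (n < N → (2 * ((N : ℤ) - (n : ℤ)) ≤ (l : ℤ) ∧ l ≤ n) ∧ 2 * (N : ℝ) / 3 ≤ (n : ℝ)) ∧
      (n = N → 0 < l ∧ l < N) := by
  obtain ⟨hn, hl⟩ := hC
  have hln : l ≤ n := hn.2 hl.1
  rw [← γ.ranks_pencil] at hn hl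
  obtain ⟨hbound, hpos, hlt⟩ := mainTheorem3_general (finrank_fin_fun ℂ) hγ.isConcise_pencil hn hl
  rw [finrank_fin_fun] at hbound hlt
  refine ⟨fun _ => ⟨⟨by omega, hln⟩, ?_⟩, fun _ => ⟨hpos, hlt rfl⟩⟩
  have h3 : 2 * (N : ℝ) ≤ 3 * n := by exact_mod_cast (by omega : 2 * N ≤ 3 * n)
  linarith
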